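/- Let $V_6$ be a $6$-dimensional complex vector space, and let $\bigwedge^3V_6$ carry the $\bigwedge^6V_6$-valued symplectic form given by wedge product. Let $A\subset\bigwedge^3V_6$ be a Lagrangian subspace containing no nonzero decomposable vector $v_1\wedge v_2\wedge v_3$. Let $U_0\subset V_6$ be a $3$-dimensional subspace, set $T_{U_0}:=\bigwedge^2U_0\wedge V_6\subset\bigwedge^3V_6$ and $K:=A\cap T_{U_0}$, and assume that $k:=\dim K\in\{1,2,3,4\}$. Let $\mathscr C_{U_0}:=\mathbf P(T_{U_0})\cap \mathrm{Gr}(3,V_6)\subset \mathbf P(\bigwedge^3V_6)$ be the cone of decomposable vectors in $T_{U_0}$, let $H^0(\mathbf P(T_{U_0}),I_{\mathscr C_{U_0}}(2))$ be the space of quadratic forms on $T_{U_0}$ that vanish on $\mathscr C_{U_0}$, and let $$r_K\colon H^0(\mathbf P(T_{U_0}),I_{\mathscr C_{U_0}}(2))\longrightarrow H^0(\mathbf P(K),\mathscr O(2))\simeq \mathrm{Sym}^2K^\vee$$ be the restriction map $q\mapsto q|_K$. Then: (a) if $k\in\{1,2,3\}$, the map $r_K$ is surjective and its kernel has dimension $9-\frac{k(k+1)}2$;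 (b) if $k=4$, the map $r_K$ is injective and its image is a hyperplane in $\mathrm{Sym}^2K^\vee$; this hyperplane is the annihilator of an element of $\mathrm{Sym}^2K$ of maximal rank $4$, that is, of a nondegenerate symmetric tensor. -/

import Mathlib

open scoped TensorProduct

noncomputable section

namespace EPWCube

variable {V : Type*} [AddCommGroup V] [Module ℂ V]

/-- A trivector is decomposable if it is of the form `v₁ ∧ v₂ ∧ v₃` (zero is included). -/
def IsDecomposable (x : ⋀[ℂ]^3 V) : Prop :=
  ∃ v : Fin 3 → V, exteriorPower.ιMulti ℂ 3 v = x

/-- `A` contains no decomposable vectors, that is, `P(A)` does not meet the Grassmannian `Gr(3, V)`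
in its Plücker embedding. -/
def HasNoDecomposable (A : Submodule ℂ (⋀[ℂ]^3 V)) : Prop :=
  ∀ x ∈ A, IsDecomposable x → x = 0

/-- Lagrangian subspaces of `⋀³ V` for the `⋀⁶ V`-valued symplectic form given by wedge product
(computed in the exterior algebra): `A` is its own orthogonal. -/
def IsLagrangian (A : Submodule ℂ (⋀[ℂ]^3 V)) : Prop :=
  ∀ x : ⋀[ℂ]^3 V,
    x ∈ A ↔ ∀ y ∈ A, (x : ExteriorAlgebra ℂ V) * (y : ExteriorAlgebra ℂ V) = 0

/-- `T_U = ⋀² U ∧ V`, the span of the `u₁ ∧ u₂ ∧ v` with `u₁, u₂ ∈ U` and `v ∈ V`. -/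
def tangentSpace (U : Submodule ℂ V) : Submodule ℂ (⋀[ℂ]^3 V) :=
  Submodule.span ℂ
    {x | ∃ u₁ ∈ U, ∃ u₂ ∈ U, ∃ v : V, x = exteriorPower.ιMulti ℂ 3 ![u₁, u₂, v]}

/-- The subspace `K = A ∩ T_U` of `⋀³ V`. -/
abbrev interTangent (A : Submodule ℂ (⋀[ℂ]^3 V)) (U : Submodule ℂ V) :
    Submodule ℂ (⋀[ℂ]^3 V) :=
  A ⊓ tangentSpace U

/-- The stratum `Z^k_A` of `Gr(3, V)`: the three-dimensional `U` with `dim (A ∩ T_U) = k`. -/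
def stratum (A : Submodule ℂ (⋀[ℂ]^3 V)) (k : ℕ) : Set (Submodule ℂ V) :=
  {U | Module.finrank ℂ U = 3 ∧ Module.finrank ℂ (interTangent A U) = k}

/-- `H⁰(P(T_U), I_{C_U}(2))`: the quadratic forms on `T_U` that vanish on the cone
`C_U = P(T_U) ∩ Gr(3, V)`, that is, on all the decomposable vectors of `T_U`. -/
def quadricsThroughCone (U : Submodule ℂ V) : Submodule ℂ (QuadraticForm ℂ (tangentSpace U)) where
  carrier := {q | ∀ x : tangentSpace U, IsDecomposable (x : ⋀[ℂ]^3 V) → q x = 0}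
  zero_mem' := fun _ _ => rfl
  add_mem' := fun {p q} hp hq x hx => by simp [hp x hx, hq x hx]
  smul_mem' := fun c q hq x hx => by simp [hq x hx]

/-- Pullback of quadratic forms along a linear map, as a linear map. -/
def quadPullback {W W' : Type*} [AddCommMonoid W] [Module ℂ W] [AddCommMonoid W'] [Module ℂ W']
    (f : W' →ₗ[ℂ] W) : QuadraticForm ℂ W →ₗ[ℂ] QuadraticForm ℂ W' where
  toFun q := q.comp f
  map_add' _ _ := rfl
  map_smul' _ _ := rfl

/-- The restriction map `r_K`, for `K = A ∩ T_U`, from the quadrics in `P(T_U)` containing the cone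
`C_U` to the quadrics in `P(K)`; the target `QuadraticForm ℂ K` is `Sym² K^∨`. -/
def restrictionMap (A : Submodule ℂ (⋀[ℂ]^3 V)) (U : Submodule ℂ V) :
    quadricsThroughCone U →ₗ[ℂ] QuadraticForm ℂ (interTangent A U) :=
  (quadPullback (Submodule.inclusion inf_le_right)).domRestrict (quadricsThroughCone U)

section SymmetricTensors

variable (K : Type*) [AddCommGroup K] [Module ℂ K]

/-- `Sym² K`, as the space of symmetric tensors in `K ⊗ K`. -/
def symTensors : Submodule ℂ (K ⊗[ℂ] K) :=
  LinearMap.eqLocus (TensorProduct.comm ℂ K K).toLinearMap LinearMap.id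

variable {K}

/-- The linear map `K^∨ → K` associated with a tensor `p ∈ K ⊗ K`, namely `f ↦ (f ⊗ id) p`. -/
def contraction (p : K ⊗[ℂ] K) : Module.Dual ℂ K →ₗ[ℂ] K where
  toFun f := TensorProduct.lid ℂ K (f.rTensor K p)
  map_add' f g := by rw [LinearMap.rTensor_add, LinearMap.add_apply, map_add]
  map_smul' c f := by rw [LinearMap.rTensor_smul, LinearMap.smul_apply, map_smul, RingHom.id_apply]

/-- The rank of a tensor `p ∈ K ⊗ K`: the rank of the associated linear map `K^∨ → K`. -/
def tensorRank (p : K ⊗[ℂ] K) : ℕ :=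
  Module.finrank ℂ (LinearMap.range (contraction p))

/-- The natural pairing of a quadratic form `q` on `K` with a tensor `p ∈ K ⊗ K`, as a linear
form in `q`: it sends `x ⊗ y` to `B_q(x, y)`, where `B_q` is the symmetric bilinear form with
`B_q(x, x) = q(x)`. Restricted to symmetric `p`, it is the duality between `Sym² K^∨` and
`Sym² K`. -/
def evalAtTensor (p : K ⊗[ℂ] K) : QuadraticForm ℂ K →ₗ[ℂ] ℂ :=
  LinearMap.applyₗ p ∘ₗ (TensorProduct.lift.equiv (RingHom.id ℂ) K K ℂ).toLinearMap ∘ₗ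
    QuadraticMap.associated

/-- The subspace of `Sym² K^∨` defined by the element `p` of `Sym² K` (a hyperplane when
`p ≠ 0`). -/
def hyperplaneOf (p : symTensors K) : Submodule ℂ (QuadraticForm ℂ K) :=
  LinearMap.ker (evalAtTensor (p : K ⊗[ℂ] K))

end SymmetricTensors

end EPWCube

end

namespace EPWCube

/-! ### Apolar symmetric maps and rank one vectors -/

section KeyLemma

/-! A basis adapted to `U₀` identifies `T_U` with `ℂ ⊕ M₃(ℂ)`, the decomposable vectors being the
pairs `(c, M)` with `M` of rank at most one (`isDecomposable_iff`). So the quadrics through the cone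
form the 9-dimensional span of the `2 × 2` minors, and the hypothesis on `A` says that no nonzero
vector of `K` has a matrix of rank at most one.

By duality, the image of the restriction map is cut out by the linear forms `φ` on quadratic forms
of `K` that kill all restricted minors. Such a `φ` is a symmetric map `D : K^∨ → K`, and the
condition on minors is apolarity (`IsApolar`). The heart is `IsApolar.exists_isRankOne`: a nonzero
apolar `D` of rank at most 3 forces a nonzero rank one vector in `K`. Hence every nonzero `φ` has
rank at least 4.

If `k ≤ 3` there is no such `φ`, so restriction is surjective. If `k = 4`, the source has dimension
9 and the target 10, so some `φ ≠ 0` exists, necessarily nondegenerate. Two independent ones would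
span a pencil with a degenerate nonzero member, so `φ` is unique up to scale, the image is the
hyperplane `ker φ`, and injectivity follows by dimension. -/

/-- In a minimal nonzero invariant subspace, commutativity makes the eigenspaces of each operator
invariant, so each operator acts on it as a scalar. -/
theorem exists_common_eigenvector {E ι : Type*} [AddCommGroup E] [Module ℂ E]
    [FiniteDimensional ℂ E] [Nontrivial E] (N : ι → Module.End ℂ E)
    (hN : ∀ i j, Commute (N i) (N j)) :
    ∃ v : E, v ≠ 0 ∧ ∀ i, ∃ μ : ℂ, N i v = μ • v := by
  obtain ⟨W, ⟨hW0, hWN⟩, hmin⟩ := wellFounded_lt.has_min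
    {W : Submodule ℂ E | W ≠ ⊥ ∧ ∀ i, ∀ w ∈ W, N i w ∈ W}
    ⟨⊤, top_ne_bot, fun _ _ _ => Submodule.mem_top⟩
  obtain ⟨v, hvW, hv0⟩ := Submodule.exists_mem_ne_zero_of_ne_bot hW0
  have : Nontrivial W := Submodule.nontrivial_iff_ne_bot.2 hW0
  refine ⟨v, hv0, fun i => ?_⟩
  obtain ⟨μ, hμ⟩ := Module.End.exists_eigenvalue ((N i).restrict (hWN i))
  obtain ⟨w, hw, hw0⟩ := hμ.exists_hasEigenvector
  rw [Module.End.mem_eigenspace_iff] at hw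
  have hw' : N i w = μ • (w : E) := congrArg Subtype.val hw
  have hle : ¬ (W ⊓ (N i).eigenspace μ < W) := by
    apply hmin
    refine ⟨fun h => hw0 (Subtype.ext ?_), fun j x hx => ⟨hWN j x hx.1, ?_⟩⟩
    · have : (w : E) ∈ W ⊓ (N i).eigenspace μ :=
        ⟨w.2, Module.End.mem_eigenspace_iff.2 hw'⟩
      rw [h] at this
      simpa using this
    · have hx2 := Module.End.mem_eigenspace_iff.1 hx.2
      refine Module.End.mem_eigenspace_iff.2 ?_
      rw [← Module.End.mul_apply, (hN i j).eq,
        Module.End.mul_apply, hx2, map_smul]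
  have heq : W ⊓ (N i).eigenspace μ = W := by
    by_contra h
    exact hle (lt_of_le_of_ne inf_le_left h)
  rw [← heq] at hvW
  exact ⟨μ, Module.End.mem_eigenspace_iff.1 hvW.2⟩

variable {K P Q : Type*} [AddCommGroup K] [Module ℂ K]
  [AddCommGroup P] [Module ℂ P] [AddCommGroup Q] [Module ℂ Q]

/-- The vector `t` is a rank one tensor with respect to the family of linear forms `f a b`. -/
def IsRankOne (f : P →ₗ[ℂ] Q →ₗ[ℂ] Module.Dual ℂ K) (t : K) : Prop :=
  ∃ (α : Module.Dual ℂ P) (β : Module.Dual ℂ Q), ∀ a b, f a b t = α a * β b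

theorem IsRankOne.of_flip {f : P →ₗ[ℂ] Q →ₗ[ℂ] Module.Dual ℂ K} {t : K}
    (h : IsRankOne f.flip t) : IsRankOne f t := by
  obtain ⟨α, β, h⟩ := h
  exact ⟨β, α, fun a b => by rw [mul_comm, ← h, LinearMap.flip_apply]⟩

/-- A symmetric map `D : K^∨ → K` apolar to all the `2 × 2` minors of the family `f`. -/
structure IsApolar (f : P →ₗ[ℂ] Q →ₗ[ℂ] Module.Dual ℂ K) (D : Module.Dual ℂ K →ₗ[ℂ] K) :
    Prop where
  symm : ∀ g h : Module.Dual ℂ K, g (D h) = h (D g)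
  minor : ∀ a b c d, f c d (D (f a b)) = f c b (D (f a d))

variable {f : P →ₗ[ℂ] Q →ₗ[ℂ] Module.Dual ℂ K} {D : Module.Dual ℂ K →ₗ[ℂ] K}

/-- Minors are stable under transposition, so every argument about rows also serves for columns. -/
theorem IsApolar.flip (h : IsApolar f D) : IsApolar f.flip D where
  symm := h.symm
  minor a b c d := by
    simp only [LinearMap.flip_apply]
    rw [h.minor, h.symm]

/-- If the image of `f a₀` under `D` is the line spanned by `t`, then `t` has rank one. -/
theorem IsApolar.isRankOne_of_line (h : IsApolar f D) (a₀ : P) (t : K) (ht : t ≠ 0)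
    (hspan : ∀ b, ∃ μ : ℂ, D (f a₀ b) = μ • t) (e : Q) (he : D (f a₀ e) ≠ 0) :
    IsRankOne f t := by
  choose μ hμ using hspan
  have hadd : ∀ b d, μ (b + d) = μ b + μ d := fun b d => smul_left_injective ℂ ht <| by
    simp only [add_smul, ← hμ, map_add]
  have hsmul : ∀ (s : ℂ) b, μ (s • b) = s * μ b := fun s b => smul_left_injective ℂ ht <| by
    simp only [mul_smul, ← hμ, map_smul]
  have hμe : μ e ≠ 0 := fun h0 => he (by rw [hμ, h0, zero_smul])
  -- Apolarity reads `μ e * f c d t = μ d * f c e t`; dividing by `μ e` separates `c` from `d`.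
  refine ⟨(μ e)⁻¹ • (LinearMap.flip f e).flip t, ⟨⟨μ, hadd⟩, hsmul⟩, fun c d => ?_⟩
  have := h.minor a₀ e c d
  rw [hμ, hμ, map_smul, map_smul, smul_eq_mul, smul_eq_mul] at this
  simp only [LinearMap.smul_apply, LinearMap.flip_apply, smul_eq_mul, LinearMap.coe_mk,
    AddHom.coe_mk]
  field_simp
  linear_combination this

/-- If `D` maps the range of `f a₀` onto the range of `D`, a rank one vector is obtained as a common
eigenvector of a commuting family of symmetric endomorphisms. -/
theorem IsApolar.exists_isRankOne_of_surjective [FiniteDimensional ℂ K] (h : IsApolar f D)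
    (hD : D ≠ 0) (a₀ : P) (hsurj : ∀ g, ∃ b, D (f a₀ b) = D g) :
    ∃ t : K, t ≠ 0 ∧ IsRankOne f t := by
  let E := LinearMap.range D
  have : Nontrivial E := by
    rw [Submodule.nontrivial_iff_ne_bot, ne_eq, LinearMap.range_eq_bot]
    exact hD
  let L : P → Q →ₗ[ℂ] E := fun c => D.rangeRestrict ∘ₗ f c
  have hL : ∀ c b, (L c b : K) = D (f c b) := fun _ _ => rfl
  have hLs : Function.Surjective (L a₀) := by
    rintro ⟨_, g, rfl⟩
    obtain ⟨b, hb⟩ := hsurj g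
    exact ⟨b, Subtype.ext hb⟩
  -- This makes `D (f a₀ b) ↦ D (f c b)` a well-defined endomorphism `N c` of the range of `D`.
  have hker : ∀ c, LinearMap.ker (L a₀) ≤ LinearMap.ker (L c) := by
    intro c b hb
    rw [LinearMap.mem_ker] at hb ⊢
    have hb' : D (f a₀ b) = 0 := congrArg Subtype.val hb
    apply Subtype.ext
    rw [hL, ZeroMemClass.coe_zero, ← Module.forall_dual_apply_eq_zero_iff ℂ]
    intro g
    obtain ⟨d, hd⟩ := hsurj g
    rw [h.symm, ← hd, h.minor, hb', map_zero]
  let N : P → Module.End ℂ E := fun c =>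
    (Submodule.liftQ _ (L c) (hker c)) ∘ₗ ((L a₀).quotKerEquivOfSurjective hLs).symm.toLinearMap
  have hN : ∀ c b, N c (L a₀ b) = L c b := by
    intro c b
    have : ((L a₀).quotKerEquivOfSurjective hLs).symm (L a₀ b) = Submodule.Quotient.mk b := by
      rw [LinearEquiv.symm_apply_eq]; rfl
    simp only [N, LinearMap.comp_apply, LinearEquiv.coe_coe, this]
    rfl
  have hsep : ∀ t : E, (∀ b, f a₀ b t = 0) → t = 0 := by
    rintro ⟨_, g, rfl⟩ hg
    apply Subtype.ext
    rw [ZeroMemClass.coe_zero, ← Module.forall_dual_apply_eq_zero_iff ℂ]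
    intro g'
    obtain ⟨b, hb⟩ := hsurj g'
    rw [h.symm, ← hb, ← h.symm]
    exact hg b
  have hfN : ∀ c b (t : E), f a₀ b (N c t) = f c b t := by
    intro c b t
    obtain ⟨d, rfl⟩ := hLs t
    rw [hN, hL, hL, h.symm, h.minor]
  -- The forms `f a₀ b` separate points of `E`. Paired with one of them, the two products at `D (f
  -- a₀ d)` become `f c b (D (f c' d))` and `f c' b (D (f c d))`, equal by apolarity and symmetry.
  have hcomm : ∀ c c', Commute (N c) (N c') := by
    intro c c'
    ext1 t
    rw [← sub_eq_zero]
    apply hsep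
    intro b
    obtain ⟨d, rfl⟩ := hLs t
    rw [Submodule.coe_sub, map_sub, sub_eq_zero, Module.End.mul_apply, Module.End.mul_apply, hfN,
      hfN, hN, hN, hL, hL, h.minor, h.symm]
  obtain ⟨v, hv, hev⟩ := exists_common_eigenvector N hcomm
  obtain ⟨e, he⟩ : ∃ e, f a₀ e v ≠ 0 := by
    by_contra! hcon
    exact hv (hsep v hcon)
  refine ⟨v, by simpa using hv, (f a₀ e v)⁻¹ • (LinearMap.flip f e).flip (v : K),
    (f a₀).flip (v : K), fun c b => ?_⟩
  obtain ⟨μ, hμ⟩ := hev c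
  have key : ∀ b, f c b v = μ * f a₀ b v := by
    intro b
    rw [← hfN, hμ, Submodule.coe_smul, map_smul, smul_eq_mul]
  simp only [LinearMap.smul_apply, LinearMap.flip_apply, smul_eq_mul, key]
  field_simp

/-- If `D` does not map the range of `f a₀` onto the range of `D`, there is a nonzero vector in the
range of `D` that is orthogonal to the range of `f a₀`. -/
theorem IsApolar.exists_orthogonal [FiniteDimensional ℂ K] (h : IsApolar f D) (a₀ : P)
    (hns : ¬ ∀ g, ∃ b, D (f a₀ b) = D g) :
    ∃ g, D g ≠ 0 ∧ ∀ b, f a₀ b (D g) = 0 := by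
  push Not at hns
  obtain ⟨g', hg'⟩ := hns
  obtain ⟨g, hg, hle⟩ := Submodule.exists_le_ker_of_notMem
    (p := LinearMap.range (D ∘ₗ f a₀)) (v := D g') (by rintro ⟨b, hb⟩; exact hg' b hb)
  refine ⟨g, fun h0 => hg ?_, fun b => ?_⟩
  · rw [h.symm, h0, map_zero]
  · rw [h.symm]
    exact hle ⟨b, rfl⟩

theorem exists_eq_mul_of_finrank_range_le_one (F : P →ₗ[ℂ] Module.Dual ℂ Q)
    [FiniteDimensional ℂ (LinearMap.range F)] (hF : Module.finrank ℂ (LinearMap.range F) ≤ 1) :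
    ∃ (α : Module.Dual ℂ P) (β : Module.Dual ℂ Q), ∀ a b, F a b = α a * β b := by
  obtain ⟨⟨v, hv⟩, hvs⟩ := finrank_le_one_iff.1 hF
  have hvs' : ∀ a, ∃ s : ℂ, s • v = F a := fun a => by
    obtain ⟨s, hs⟩ := hvs ⟨F a, a, rfl⟩
    exact ⟨s, congrArg Subtype.val hs⟩
  by_cases hv0 : v = 0
  · refine ⟨0, 0, fun a b => ?_⟩
    obtain ⟨s, hs⟩ := hvs' a
    simp [← hs, hv0]
  · obtain ⟨e, he⟩ : ∃ e, v e ≠ 0 := by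
      by_contra! hcon
      exact hv0 (LinearMap.ext hcon)
    refine ⟨(v e)⁻¹ • F.flip e, v, fun a b => ?_⟩
    obtain ⟨s, hs⟩ := hvs' a
    simp only [LinearMap.smul_apply, LinearMap.flip_apply, ← hs, smul_eq_mul]
    field_simp

/-- If `f a₀` is killed by `D`, with `P` three-dimensional, a rank one vector exists unless
`D` maps the range of some `f a` onto the range of `D`. -/
theorem IsApolar.exists_isRankOne_of_zero [FiniteDimensional ℂ K] (h : IsApolar f D)
    (hP : Module.finrank ℂ P = 3) (hns : ∀ a, ¬ ∀ g, ∃ b, D (f a b) = D g)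
    (a₀ : P) (ha₀ : a₀ ≠ 0) (hz : ∀ b, D (f a₀ b) = 0) :
    ∃ t : K, t ≠ 0 ∧ IsRankOne f t := by
  have : FiniteDimensional ℂ P := Module.finite_of_finrank_eq_succ hP
  have h1 : Module.finrank ℂ (Submodule.span ℂ {a₀}) = 1 := finrank_span_singleton ha₀
  obtain ⟨a₁, ha₁⟩ : ∃ a₁, a₁ ∉ Submodule.span ℂ {a₀} := by
    by_contra! hcon
    rw [(Submodule.eq_top_iff'.2 hcon), finrank_top, hP] at h1
    omega
  have hli : LinearIndependent ℂ ![a₀, a₁] := by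
    rw [LinearIndependent.pair_iff' ha₀]
    exact fun s hs => ha₁ (Submodule.mem_span_singleton.2 ⟨s, hs⟩)
  obtain ⟨g, hg, hgb⟩ := h.exists_orthogonal a₁ (hns a₁)
  let F : P →ₗ[ℂ] Module.Dual ℂ Q :=
    LinearMap.mk₂ ℂ (fun a b => f a b (D g)) (by simp) (by simp) (by simp) (by simp)
  -- A plane in the kernel, inside the three-dimensional `P`, leaves `F` rank at most one.
  have hle : Submodule.span ℂ (Set.range ![a₀, a₁]) ≤ LinearMap.ker F := by
    rw [Submodule.span_le]
    rintro _ ⟨i, rfl⟩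
    fin_cases i
    · exact LinearMap.ext fun b => by
        change f a₀ b (D g) = 0
        rw [h.symm, hz, map_zero]
    · exact LinearMap.ext hgb
  have h2 := Submodule.finrank_mono hle
  rw [finrank_span_eq_card hli, Fintype.card_fin] at h2
  have h3 := LinearMap.finrank_range_add_finrank_ker F
  exact ⟨D g, hg, exists_eq_mul_of_finrank_range_le_one F (by omega)⟩

/-- The image under `D` of the annihilator of the subspace `S` of the range of `D` has
complementary dimension. -/
theorem finrank_map_dualAnnihilator_add [FiniteDimensional ℂ K]
    (hD : ∀ g h : Module.Dual ℂ K, g (D h) = h (D g)) (S : Submodule ℂ K)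
    (hS : S ≤ LinearMap.range D) :
    Module.finrank ℂ (S.dualAnnihilator.map D) + Module.finrank ℂ S =
      Module.finrank ℂ (LinearMap.range D) := by
  -- Hence restricting `D` to the annihilator loses the whole kernel of `D`, and the rest is a
  -- dimension count.
  have hker : LinearMap.ker D ≤ S.dualAnnihilator := by
    intro g hg
    rw [Submodule.mem_dualAnnihilator]
    intro x hx
    obtain ⟨g', rfl⟩ := hS hx
    rw [hD, LinearMap.mem_ker.1 hg, map_zero]
  have h1 := LinearMap.finrank_range_add_finrank_ker (D.domRestrict S.dualAnnihilator)
  have h2 := LinearMap.finrank_range_add_finrank_ker D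
  have h3 := Subspace.finrank_add_finrank_dualAnnihilator_eq S
  rw [LinearMap.range_domRestrict] at h1
  have h4 : Module.finrank ℂ (LinearMap.ker (D.domRestrict S.dualAnnihilator)) =
      Module.finrank ℂ (LinearMap.ker D) := by
    rw [LinearMap.ker_domRestrict]
    exact (Submodule.comapSubtypeEquivOfLe hker).finrank_eq
  have h5 : Module.finrank ℂ (Module.Dual ℂ K) = Module.finrank ℂ K := Subspace.dual_finrank_eq
  omega

/-- An apolar map of rank at most three has a rank one vector, when the forms `f a b` span the
dual space. -/
theorem IsApolar.exists_isRankOne [FiniteDimensional ℂ K] (h : IsApolar f D) (hD : D ≠ 0)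
    (hP : Module.finrank ℂ P = 3)
    (hrank : Module.finrank ℂ (LinearMap.range D) ≤ 3)
    (hsep : ∀ x : K, (∀ a b, f a b x = 0) → x = 0) :
    ∃ t : K, t ≠ 0 ∧ IsRankOne f t := by
  by_cases hs : ∃ a, ∀ g, ∃ b, D (f a b) = D g
  · obtain ⟨a, ha⟩ := hs
    exact h.exists_isRankOne_of_surjective hD a ha
  by_cases hs' : ∃ b, ∀ g, ∃ a, D (f a b) = D g
  · obtain ⟨b, hb⟩ := hs'
    obtain ⟨t, ht, hr⟩ := h.flip.exists_isRankOne_of_surjective hD b hb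
    exact ⟨t, ht, hr.of_flip⟩
  push Not at hs hs'
  have : FiniteDimensional ℂ P := Module.finite_of_finrank_eq_succ hP
  obtain ⟨a, b, hab⟩ : ∃ a b, D (f a b) ≠ 0 := by
    by_contra! hcon
    refine hD (LinearMap.ext fun g => hsep _ fun a b => ?_)
    rw [h.symm, hcon, map_zero]
  let S := LinearMap.range (D ∘ₗ f.flip b)
  have hSle : S ≤ LinearMap.range D := LinearMap.range_comp_le_range _ _
  have hSlt : Module.finrank ℂ S < Module.finrank ℂ (LinearMap.range D) := by
    refine Submodule.finrank_lt_finrank_of_lt (lt_of_le_of_ne hSle fun heq => ?_)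
    obtain ⟨g, hg⟩ := hs' b
    have : D g ∈ S := heq ▸ ⟨g, rfl⟩
    obtain ⟨c, hc⟩ := this
    exact hg c hc
  have hdim := finrank_map_dualAnnihilator_add h.symm S hSle
  by_cases hS1 : Module.finrank ℂ S ≤ 1
  · have hline : ∀ c, ∃ μ : ℂ, D (f.flip b c) = μ • D (f.flip b a) := by
      intro c
      have hne : (⟨D (f.flip b a), a, rfl⟩ : S) ≠ 0 := fun h0 => hab (congrArg Subtype.val h0)
      obtain ⟨s, hs⟩ := (finrank_eq_one_iff_of_nonzero' _ hne).1
        (le_antisymm hS1 (Module.finrank_pos_iff_exists_ne_zero.2 ⟨_, hne⟩)) ⟨_, c, rfl⟩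
      exact ⟨s, (congrArg Subtype.val hs).symm⟩
    exact ⟨_, hab, (h.flip.isRankOne_of_line b _ hab hline a hab).of_flip⟩
  -- Only `dim S = 2` with `D` of rank 3 remains. The orthogonal of `S` in the range of `D` is a
  -- line, and `dim P = 3 > dim S` gives some `a₀ ≠ 0` with `D (f a₀ b) = 0`; apolarity then puts
  -- every `D (f a₀ d)` on that line.
  have hE : Module.finrank ℂ (S.dualAnnihilator.map D) = 1 := by omega
  obtain ⟨a₀, ha₀, ha₀b⟩ : ∃ a₀ : P, a₀ ≠ 0 ∧ D (f a₀ b) = 0 := by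
    have hrk := LinearMap.finrank_range_add_finrank_ker (D ∘ₗ f.flip b)
    have hpos : 0 < Module.finrank ℂ (LinearMap.ker (D ∘ₗ f.flip b)) := by
      change Module.finrank ℂ S + _ = _ at hrk
      omega
    obtain ⟨⟨x, hx⟩, hx0⟩ := Module.finrank_pos_iff_exists_ne_zero.1 hpos
    exact ⟨x, fun h0 => hx0 (Subtype.ext h0), hx⟩
  have hmem : ∀ d, D (f a₀ d) ∈ S.dualAnnihilator.map D := by
    refine fun d => ⟨f a₀ d, ?_, rfl⟩
    rw [SetLike.mem_coe, Submodule.mem_dualAnnihilator]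
    rintro _ ⟨c, rfl⟩
    change f a₀ d (D (f c b)) = 0
    rw [h.symm, ← h.minor, ha₀b, map_zero]
  by_cases hz : ∀ d, D (f a₀ d) = 0
  · exact h.exists_isRankOne_of_zero hP (fun a ha => (hs a).elim fun g hg =>
      (ha g).elim fun b hb => hg b hb) a₀ ha₀ hz
  · push Not at hz
    obtain ⟨e, he⟩ := hz
    have hne : (⟨_, hmem e⟩ : S.dualAnnihilator.map D) ≠ 0 :=
      fun h0 => he (congrArg Subtype.val h0)
    refine ⟨_, he, h.isRankOne_of_line a₀ _ he (fun d => ?_) e he⟩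
    obtain ⟨s, hs⟩ := (finrank_eq_one_iff_of_nonzero' _ hne).1 hE ⟨_, hmem d⟩
    exact ⟨s, (congrArg Subtype.val hs).symm⟩

end KeyLemma

/-! ### Quadratic forms, and their linear functionals as symmetric maps and tensors -/

section QuadraticForms

open QuadraticMap

variable {K : Type*} [AddCommGroup K] [Module ℂ K]

theorem quadraticForm_eq_zero_of_polar_basis {ι : Type*} (b : Module.Basis ι ℂ K)
    (q : QuadraticForm ℂ K) (h : ∀ i j, polar q (b i) (b j) = 0) : q = 0 := by
  have hB : q.polarBilin = 0 := b.ext fun i => b.ext fun j => h i j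
  ext x
  have h1 : polar q x x = 2 • q x := polar_self q x
  have h2 : q.polarBilin x x = 0 := by rw [hB]; rfl
  rw [polarBilin_apply_apply, h1] at h2
  simpa using h2

theorem polar_linMulLin (f g : Module.Dual ℂ K) (x y : K) :
    polar (linMulLin f g) x y = f x * g y + f y * g x := by
  simp only [polar, linMulLin_apply, map_add]
  ring

/-- The coordinates of a quadratic form in a basis, indexed by unordered pairs. -/
noncomputable def quadraticFormCoords {ι : Type*} (b : Module.Basis ι ℂ K) :
    QuadraticForm ℂ K →ₗ[ℂ] (Sym2 ι → ℂ) where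
  toFun q := Sym2.lift ⟨fun i j => polar q (b i) (b j), fun i j => polar_comm q _ _⟩
  map_add' p q := by
    ext s
    induction s with | _ i j
    exact polar_add p q _ _
  map_smul' c q := by
    ext s
    induction s with | _ i j
    exact polar_smul q c _ _

theorem quadraticFormCoords_bijective {ι : Type*} [Finite ι] (b : Module.Basis ι ℂ K) :
    Function.Bijective (quadraticFormCoords b) := by
  classical
  have := Fintype.ofFinite ι
  constructor
  · rw [← LinearMap.ker_eq_bot, LinearMap.ker_eq_bot']
    intro q hq
    exact quadraticForm_eq_zero_of_polar_basis b q fun i j => congrFun hq s(i, j)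
  · intro g
    -- The factor one half compensates for polarization on the diagonal, and for the two orderings
    -- of each pair off it.
    refine ⟨∑ i, ∑ j, (2⁻¹ * g s(i, j)) • linMulLin (b.coord i) (b.coord j), ?_⟩
    ext s
    induction s with | _ k l
    simp only [map_sum, map_smul, Finset.sum_apply, Pi.smul_apply]
    have h : ∀ i j, quadraticFormCoords b (linMulLin (b.coord i) (b.coord j)) s(k, l) =
        (if k = i then 1 else 0) * (if l = j then 1 else 0) +
        (if l = i then 1 else 0) * (if k = j then 1 else 0) := by
      intro i j
      change polar _ _ _ = _
      rw [polar_linMulLin]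
      simp [Finsupp.single_apply]
    simp only [h, smul_eq_mul, mul_add, Finset.sum_add_distrib]
    simp [Sym2.eq_swap (a := l)]
    ring

theorem finrank_quadraticForm [FiniteDimensional ℂ K] :
    Module.finrank ℂ (QuadraticForm ℂ K) =
      Module.finrank ℂ K * (Module.finrank ℂ K + 1) / 2 := by
  rw [(LinearEquiv.ofBijective _ (quadraticFormCoords_bijective
    (Module.finBasis ℂ K))).finrank_eq, Module.finrank_fintype_fun_eq_card, Sym2.card,
    Fintype.card_fin, Nat.choose_two_right, Nat.add_sub_cancel, mul_comm]

instance [FiniteDimensional ℂ K] : FiniteDimensional ℂ (QuadraticForm ℂ K) :=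
  (LinearEquiv.ofBijective _ (quadraticFormCoords_bijective
    (Module.finBasis ℂ K))).symm.finiteDimensional

theorem quadraticForm_eq_sum {ι : Type*} [Fintype ι] (b : Module.Basis ι ℂ K)
    (q : QuadraticForm ℂ K) :
    q = ∑ i, ∑ j, associated q (b i) (b j) • linMulLin (b.coord i) (b.coord j) := by
  ext x
  have h := LinearMap.sum_repr_mul_repr_mul b b (B := associated q) x x
  rw [Finsupp.sum_fintype _ _ (by simp)] at h
  simp only [Finsupp.sum_fintype, zero_smul, smul_zero, implies_true] at h
  rw [← associated_eq_self_apply ℂ q x, ← h]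
  simp only [sum_apply, smul_apply, linMulLin_apply, smul_eq_mul,
    Module.Basis.coord_apply]
  exact Finset.sum_congr rfl fun i _ => Finset.sum_congr rfl fun j _ => by ring

variable [FiniteDimensional ℂ K]

/-- The symmetric map `K^∨ → K` associated with a linear form on the quadratic forms on `K`. -/
noncomputable def functionalMap (φ : Module.Dual ℂ (QuadraticForm ℂ K)) : Module.Dual ℂ K →ₗ[ℂ] K :=
  (Module.evalEquiv ℂ K).symm.toLinearMap ∘ₗ
    LinearMap.mk₂ ℂ (fun g h => φ (linMulLin g h))
      (fun _ _ _ => by rw [add_linMulLin, map_add])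
      (fun c g h => by rw [← map_smul]; congr 1; ext x; simp [mul_assoc])
      (fun _ _ _ => by rw [linMulLin_add, map_add])
      (fun c g h => by rw [← map_smul]; congr 1; ext x; simp [mul_left_comm])

theorem apply_functionalMap (φ : Module.Dual ℂ (QuadraticForm ℂ K)) (g h : Module.Dual ℂ K) :
    h (functionalMap φ g) = φ (linMulLin g h) := by
  rw [functionalMap, LinearMap.comp_apply, LinearEquiv.coe_coe,
    Module.apply_evalEquiv_symm_apply, LinearMap.mk₂_apply]

theorem functionalMap_symm (φ : Module.Dual ℂ (QuadraticForm ℂ K)) (g h : Module.Dual ℂ K) :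
    g (functionalMap φ h) = h (functionalMap φ g) := by
  rw [apply_functionalMap, apply_functionalMap]
  congr 1
  ext x
  simp [mul_comm]

theorem functionalMap_sub_smul (φ ψ : Module.Dual ℂ (QuadraticForm ℂ K)) (s : ℂ) :
    functionalMap (ψ - s • φ) = functionalMap ψ - s • functionalMap φ := by
  ext g
  rw [← sub_eq_zero, ← Module.forall_dual_apply_eq_zero_iff ℂ]
  intro h
  simp [apply_functionalMap]

theorem eq_zero_of_functionalMap_eq_zero {φ : Module.Dual ℂ (QuadraticForm ℂ K)}
    (h : functionalMap φ = 0) : φ = 0 := by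
  ext q
  rw [quadraticForm_eq_sum (Module.finBasis ℂ K) q]
  simp [← apply_functionalMap, h]

/-- The symmetric tensor associated with a linear form on the quadratic forms on `K`. -/
noncomputable def functionalTensor (φ : Module.Dual ℂ (QuadraticForm ℂ K)) : K ⊗[ℂ] K :=
  ∑ i, ∑ j, φ (linMulLin ((Module.finBasis ℂ K).coord i) ((Module.finBasis ℂ K).coord j)) •
    (Module.finBasis ℂ K i ⊗ₜ[ℂ] Module.finBasis ℂ K j)

theorem functionalTensor_mem_symTensors (φ : Module.Dual ℂ (QuadraticForm ℂ K)) :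
    functionalTensor φ ∈ symTensors K := by
  rw [symTensors, LinearMap.mem_eqLocus, functionalTensor]
  simp only [map_sum, map_smul, LinearEquiv.coe_coe, TensorProduct.comm_tmul, LinearMap.id_apply]
  rw [Finset.sum_comm]
  refine Finset.sum_congr rfl fun i _ => Finset.sum_congr rfl fun j _ => ?_
  rw [← apply_functionalMap, functionalMap_symm, apply_functionalMap]

theorem evalAtTensor_functionalTensor (φ : Module.Dual ℂ (QuadraticForm ℂ K)) :
    evalAtTensor (functionalTensor φ) = φ := by
  ext q
  conv_rhs => rw [quadraticForm_eq_sum (Module.finBasis ℂ K) q]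
  have h : ∀ x y : K, evalAtTensor (x ⊗ₜ[ℂ] y) q = associated q x y := fun _ _ => rfl
  have hadd : ∀ {ι : Type} (s : Finset ι) (p : ι → K ⊗[ℂ] K),
      evalAtTensor (∑ i ∈ s, p i) q = ∑ i ∈ s, evalAtTensor (p i) q := fun s p =>
    map_sum (TensorProduct.lift.equiv (RingHom.id ℂ) K K ℂ (associated q)) p s
  have hsmul : ∀ (c : ℂ) (p : K ⊗[ℂ] K), evalAtTensor (c • p) q = c * evalAtTensor p q :=
    fun c p => map_smul (TensorProduct.lift.equiv (RingHom.id ℂ) K K ℂ (associated q)) c p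
  simp only [functionalTensor, hadd, hsmul, h, map_sum, map_smul, smul_eq_mul]
  exact Finset.sum_congr rfl fun i _ => Finset.sum_congr rfl fun j _ => mul_comm _ _

theorem contraction_functionalTensor (φ : Module.Dual ℂ (QuadraticForm ℂ K)) :
    contraction (functionalTensor φ) = functionalMap φ := by
  refine (Module.finBasis ℂ K).dualBasis.ext fun k => ?_
  refine (Module.finBasis ℂ K).ext_elem fun l => ?_
  rw [← Module.Basis.coord_apply, ← Module.Basis.coord_apply, apply_functionalMap]
  simp [contraction, functionalTensor, Finsupp.single_apply]

theorem tensorRank_functionalTensor (φ : Module.Dual ℂ (QuadraticForm ℂ K)) :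
    tensorRank (functionalTensor φ) = Module.finrank ℂ (LinearMap.range (functionalMap φ)) := by
  rw [tensorRank, contraction_functionalTensor]

end QuadraticForms

/-! ### Quadrics through the Segre cone and their restriction to a subspace avoiding it -/

section Segre

open QuadraticMap

/-- The space `ℂ ⊕ M₃(ℂ)`, which contains the cone over the Segre variety with vertex the first
summand. -/
abbrev SegreSpace : Type := ℂ × Matrix (Fin 3) (Fin 3) ℂ

variable {S : Type*} [AddCommGroup S] [Module ℂ S] (e : S ≃ₗ[ℂ] SegreSpace)

/-- The quadratic forms vanishing on the cone over the Segre variety of rank one matrices. -/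
def segreQuadrics : Submodule ℂ (QuadraticForm ℂ S) where
  carrier := {q | ∀ (c : ℂ) (α β : Fin 3 → ℂ), q (e.symm (c, Matrix.vecMulVec α β)) = 0}
  zero_mem' := fun _ _ _ => rfl
  add_mem' := fun {p q} hp hq c α β => by simp [hp c α β, hq c α β]
  smul_mem' := fun s q hq c α β => by simp [hq c α β]

/-- The bilinear family of linear forms `M ↦ aᵗ M b`. -/
def segreForm : (Fin 3 → ℂ) →ₗ[ℂ] (Fin 3 → ℂ) →ₗ[ℂ] Module.Dual ℂ S :=
  LinearMap.mk₂ ℂ (fun a b =>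
    { toFun := fun x => a ⬝ᵥ ((e x).2.mulVec b)
      map_add' := fun x y => by simp [Matrix.add_mulVec]
      map_smul' := fun s x => by simp [Matrix.smul_mulVec] })
    (fun _ _ _ => by ext; simp [add_dotProduct])
    (fun _ _ _ => by ext; simp)
    (fun _ _ _ => by ext; simp [Matrix.mulVec_add])
    (fun _ _ _ => by ext; simp [Matrix.mulVec_smul])

theorem segreForm_apply (a b : Fin 3 → ℂ) (x : S) :
    segreForm e a b x = a ⬝ᵥ ((e x).2.mulVec b) := rfl

theorem segreForm_single (i j : Fin 3) (x : S) :
    segreForm e (Pi.single i 1) (Pi.single j 1) x = (e x).2 i j := by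
  simp [segreForm_apply]

theorem segreForm_vecMulVec (a b α β : Fin 3 → ℂ) (c : ℂ) :
    segreForm e a b (e.symm (c, Matrix.vecMulVec α β)) = (a ⬝ᵥ α) * (β ⬝ᵥ b) := by
  rw [segreForm_apply, LinearEquiv.apply_symm_apply, Matrix.vecMulVec_mulVec]
  simp [dotProduct_smul, mul_comm]

/-- The `2 × 2` minors. -/
def segreMinor (a b c d : Fin 3 → ℂ) : QuadraticForm ℂ S :=
  linMulLin (segreForm e a b) (segreForm e c d) - linMulLin (segreForm e a d) (segreForm e c b)

theorem segreMinor_mem (a b c d : Fin 3 → ℂ) : segreMinor e a b c d ∈ segreQuadrics e := by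
  intro s α β
  simp only [segreMinor, sub_apply, linMulLin_apply, segreForm_vecMulVec]
  ring

/-- The coefficients of a quadric containing the Segre cone in terms of the `2 × 2` minors. -/
def segreCoeffs : segreQuadrics e →ₗ[ℂ] Matrix (Fin 3) (Fin 3) ℂ where
  -- Indices are modulo 3: `(i, j)` labels the minor obtained by deleting row `i` and column `j`.
  toFun q := Matrix.of fun i j => polar q.1 (e.symm (0, Matrix.single (i + 1) (j + 1) 1))
    (e.symm (0, Matrix.single (i + 2) (j + 2) 1))
  map_add' p q := by
    ext i j
    exact polar_add p.1 q.1 _ _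
  map_smul' c q := by
    ext i j
    exact polar_smul q.1 c _ _

/-- The cone contains its vertex line, the lines joining it to rank one matrices, and all matrices
supported on one row or column, so the polar form vanishes on the corresponding pairs. Polarizing
once more, it is antisymmetric under exchanging columns (`p4`), which leaves one free value per
minor. -/
theorem segreCoeffs_injective : Function.Injective (segreCoeffs e) := by
  rw [← LinearMap.ker_eq_bot, LinearMap.ker_eq_bot']
  rintro ⟨q, hq⟩ hc
  have hq' : ∀ (c : ℂ) (α β : Fin 3 → ℂ), q (e.symm (c, Matrix.vecMulVec α β)) = 0 := hq
  let r : (Fin 3 → ℂ) → (Fin 3 → ℂ) → S := fun α β =>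
    e.symm (0, Matrix.vecMulVec α β)
  have hr : ∀ i j, e.symm (0, Matrix.single i j 1) = r (Pi.single i 1) (Pi.single j 1) := by
    intro i j
    simp only [r, Matrix.single_eq_single_vecMulVec_single]
  have hz : ∀ c : ℂ, q (e.symm (c, 0)) = 0 := fun c => by
    have := hq' c 0 0
    rwa [Matrix.zero_vecMulVec] at this
  have p0 : polar q (e.symm (1, 0)) (e.symm (1, 0)) = 0 := by
    simp [polar, hz, ← map_add]
  have p1 : ∀ α β, polar q (e.symm (1, 0)) (r α β) = 0 := fun α β => by
    simp [polar, r, hz, hq', ← map_add]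
  have p2 : ∀ α β β', polar q (r α β) (r α β') = 0 := fun α β β' => by
    simp [polar, r, hq', ← map_add, ← Matrix.vecMulVec_add]
  have p3 : ∀ α α' β, polar q (r α β) (r α' β) = 0 := fun α α' β => by
    simp [polar, r, hq', ← map_add, ← Matrix.add_vecMulVec]
  have p4 : ∀ α α' β β', polar q (r α β) (r α' β') = - polar q (r α β') (r α' β) := by
    intro α α' β β'
    have h := p3 α α' (β + β')
    have hadd : ∀ α, r α (β + β') = r α β + r α β' := fun α => by
      simp [r, Matrix.vecMulVec_add, ← map_add]
    rw [hadd, hadd, polar_add_left, polar_add_right, polar_add_right, p3, p3] at h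
    linear_combination h
  have p5 : ∀ a b : Fin 3, polar q (r (Pi.single (a + 1) 1) (Pi.single (b + 1) 1))
      (r (Pi.single (a + 2) 1) (Pi.single (b + 2) 1)) = 0 := fun a b => by
    rw [← hr, ← hr]
    exact congrFun (congrFun hc a) b
  have hfin : ∀ i k : Fin 3, i = k ∨ ∃ a, (i = a + 1 ∧ k = a + 2) ∨ (i = a + 2 ∧ k = a + 1) := by
    decide
  have p6 : ∀ i j k l : Fin 3, polar q (r (Pi.single i 1) (Pi.single j 1))
      (r (Pi.single k 1) (Pi.single l 1)) = 0 := by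
    intro i j k l
    rcases hfin i k with rfl | ⟨a, ⟨rfl, rfl⟩ | ⟨rfl, rfl⟩⟩
    · exact p2 _ _ _
    · rcases hfin j l with rfl | ⟨b, ⟨rfl, rfl⟩ | ⟨rfl, rfl⟩⟩
      · exact p3 _ _ _
      · exact p5 a b
      · rw [p4, p5, neg_zero]
    · rcases hfin j l with rfl | ⟨b, ⟨rfl, rfl⟩ | ⟨rfl, rfl⟩⟩
      · exact p3 _ _ _
      · rw [polar_comm, p4, p5, neg_zero]
      · rw [polar_comm, p5]
  apply Subtype.ext
  refine quadraticForm_eq_zero_of_polar_basis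
    (((Module.Basis.singleton Unit ℂ).prod (Matrix.stdBasis ℂ (Fin 3) (Fin 3))).map e.symm) q ?_
  rintro (i | ⟨i, j⟩) (k | ⟨k, l⟩)
  · simpa using p0
  · simpa [hr, Matrix.stdBasis_eq_single] using p1 _ _
  · rw [polar_comm]
    simpa [hr, Matrix.stdBasis_eq_single] using p1 _ _
  · simpa [hr, Matrix.stdBasis_eq_single] using p6 _ _ _ _

/-- The nine coordinate minors are dual to the nine coefficients. -/
theorem segreCoeffs_surjective : Function.Surjective (segreCoeffs e) := by
  have h : ∀ i j : Fin 3, ∃ q, segreCoeffs e q = Matrix.single i j 1 := by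
    intro i j
    refine ⟨⟨_, segreMinor_mem e (Pi.single (i + 1) 1) (Pi.single (j + 1) 1)
      (Pi.single (i + 2) 1) (Pi.single (j + 2) 1)⟩, ?_⟩
    ext k l
    simp only [segreCoeffs, segreMinor, LinearMap.coe_mk, AddHom.coe_mk, Matrix.of_apply,
      sub_eq_add_neg, FunLike.coe_add, FunLike.coe_neg, polar_add, polar_neg,
      polar_linMulLin, segreForm_single]
    fin_cases i <;> fin_cases k <;> fin_cases j <;> fin_cases l <;>
      simp
  rw [← LinearMap.range_eq_top, Submodule.eq_top_iff']
  intro N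
  rw [Matrix.matrix_eq_sum_single N]
  refine Submodule.sum_mem _ fun i _ => Submodule.sum_mem _ fun j _ => ?_
  obtain ⟨q, hq⟩ := h i j
  exact ⟨N i j • q, by rw [map_smul, hq, Matrix.smul_single, smul_eq_mul, mul_one]⟩

theorem finrank_segreQuadrics : Module.finrank ℂ (segreQuadrics e) = 9 := by
  rw [(LinearEquiv.ofBijective _ ⟨segreCoeffs_injective e, segreCoeffs_surjective e⟩).finrank_eq,
    Module.finrank_matrix]
  simp

instance : FiniteDimensional ℂ (segreQuadrics e) :=
  Module.finite_of_finrank_eq_succ (finrank_segreQuadrics e)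

variable {K : Type*} [AddCommGroup K] [Module ℂ K] [FiniteDimensional ℂ K]

/-- Vanishing on restricted minors is apolarity of `functionalMap φ`, so rank at most 3 would give a
nonzero vector of `K` in the Segre cone. -/
theorem three_lt_finrank_range_functionalMap (κ : K →ₗ[ℂ] S)
    (hκ : ∀ x α β, (e (κ x)).2 = Matrix.vecMulVec α β → x = 0)
    (φ : Module.Dual ℂ (QuadraticForm ℂ K)) (hφ : φ ≠ 0)
    (hR : (segreQuadrics e).map (quadPullback κ) ≤ LinearMap.ker φ) :
    3 < Module.finrank ℂ (LinearMap.range (functionalMap φ)) := by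
  by_contra! hle
  let f : (Fin 3 → ℂ) →ₗ[ℂ] (Fin 3 → ℂ) →ₗ[ℂ] Module.Dual ℂ K :=
    (segreForm e).compr₂ (Module.Dual.transpose κ)
  have hf : ∀ a b, f a b = segreForm e a b ∘ₗ κ := fun _ _ => rfl
  have hap : IsApolar f (functionalMap φ) := by
    refine ⟨functionalMap_symm φ, fun a b c d => ?_⟩
    rw [apply_functionalMap, apply_functionalMap, ← sub_eq_zero, ← map_sub]
    exact hR ⟨_, segreMinor_mem e a b c d, rfl⟩
  -- The forms separate points of `K`: a vector with zero matrix lies over the vertex, covered by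
  -- `hκ` with `α = β = 0`.
  obtain ⟨t, ht, α, β, hαβ⟩ := hap.exists_isRankOne
    (fun h => hφ (eq_zero_of_functionalMap_eq_zero h)) (by simp) hle (fun x hx => hκ x 0 0 (by
      rw [Matrix.zero_vecMulVec]
      ext i j
      rw [← segreForm_single e]
      exact hx _ _))
  refine ht (hκ t (fun i => α (Pi.single i 1)) (fun j => β (Pi.single j 1)) ?_)
  ext i j
  rw [← segreForm_single e, Matrix.vecMulVec_apply, ← hαβ]
  rfl

theorem map_quadPullback_eq_top (κ : K →ₗ[ℂ] S)
    (hκ : ∀ x α β, (e (κ x)).2 = Matrix.vecMulVec α β → x = 0) (hK : Module.finrank ℂ K ≤ 3) :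
    (segreQuadrics e).map (quadPullback κ) = ⊤ := by
  by_contra hne
  obtain ⟨φ, hφ, hle⟩ := Submodule.exists_le_ker_of_lt_top _ (lt_top_iff_ne_top.2 hne)
  have h := three_lt_finrank_range_functionalMap e κ hκ φ hφ hle
  have h' := Submodule.finrank_le (LinearMap.range (functionalMap φ))
  omega

theorem exists_map_quadPullback_eq_ker (κ : K →ₗ[ℂ] S)
    (hκ : ∀ x α β, (e (κ x)).2 = Matrix.vecMulVec α β → x = 0) (hK : Module.finrank ℂ K = 4) :
    ∃ φ : Module.Dual ℂ (QuadraticForm ℂ K), φ ≠ 0 ∧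
      (segreQuadrics e).map (quadPullback κ) = LinearMap.ker φ ∧
      Module.finrank ℂ (LinearMap.range (functionalMap φ)) = 4 := by
  have hdim : Module.finrank ℂ (QuadraticForm ℂ K) = 10 := by rw [finrank_quadraticForm, hK]
  have hne : (segreQuadrics e).map (quadPullback κ) ≠ ⊤ := fun h => by
    have h1 := Submodule.finrank_map_le (quadPullback κ) (segreQuadrics e)
    rw [h, finrank_top, hdim, finrank_segreQuadrics e] at h1
    omega
  have hfull : ∀ φ : Module.Dual ℂ (QuadraticForm ℂ K), φ ≠ 0 →
      (segreQuadrics e).map (quadPullback κ) ≤ LinearMap.ker φ →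
      Module.finrank ℂ (LinearMap.range (functionalMap φ)) = 4 := fun φ hφ hle => by
    have h := three_lt_finrank_range_functionalMap e κ hκ φ hφ hle
    have h' := Submodule.finrank_le (LinearMap.range (functionalMap φ))
    omega
  obtain ⟨φ, hφ, hle⟩ := Submodule.exists_le_ker_of_lt_top _ (lt_top_iff_ne_top.2 hne)
  refine ⟨φ, hφ, le_antisymm hle fun q hq => ?_, hfull φ hφ hle⟩
  by_contra hqR
  obtain ⟨ψ, hψq, hψ⟩ := Submodule.exists_le_ker_of_notMem hqR
  have hdual : Module.finrank ℂ (Module.Dual ℂ K) = Module.finrank ℂ K :=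
    Subspace.dual_finrank_eq
  have : Nontrivial (Module.Dual ℂ K) := Module.nontrivial_of_finrank_pos (R := ℂ) (by omega)
  have hsurj : LinearMap.range (functionalMap φ) = ⊤ :=
    Submodule.eq_top_of_finrank_eq (by rw [hfull φ hφ hle, hK])
  let e : Module.Dual ℂ K ≃ₗ[ℂ] K := LinearEquiv.ofBijective (functionalMap φ)
    ⟨(LinearMap.injective_iff_surjective_of_finrank_eq_finrank hdual).2
      (LinearMap.range_eq_top.1 hsurj), LinearMap.range_eq_top.1 hsurj⟩
  -- An eigenvalue `s` of `φ⁻¹ψ` makes `ψ - s • φ` degenerate. It still kills the image and is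
  -- nonzero, since `φ` vanishes at `q` and `ψ` does not; this contradicts `hfull`.
  obtain ⟨s, hs⟩ := Module.End.exists_eigenvalue (e.symm.toLinearMap ∘ₗ functionalMap ψ)
  obtain ⟨g, hg, hg0⟩ := hs.exists_hasEigenvector
  rw [Module.End.mem_eigenspace_iff, LinearMap.comp_apply, LinearEquiv.coe_coe,
    LinearEquiv.symm_apply_eq, map_smul] at hg
  have hker : functionalMap (ψ - s • φ) g = 0 := by
    rw [functionalMap_sub_smul, LinearMap.sub_apply, LinearMap.smul_apply, hg]
    exact sub_self _
  have hne0 : ψ - s • φ ≠ 0 := fun h0 => by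
    have := LinearMap.congr_fun h0 q
    rw [LinearMap.sub_apply, LinearMap.smul_apply, LinearMap.mem_ker.1 hq, smul_zero,
      sub_zero] at this
    exact hψq this
  have h4 := hfull _ hne0 fun x hx => by
    rw [LinearMap.mem_ker, LinearMap.sub_apply, LinearMap.smul_apply,
      LinearMap.mem_ker.1 (hle hx), LinearMap.mem_ker.1 (hψ hx), smul_zero, sub_zero]
  have h5 := LinearMap.finrank_range_add_finrank_ker (functionalMap (ψ - s • φ))
  have h6 : 0 < Module.finrank ℂ (LinearMap.ker (functionalMap (ψ - s • φ))) :=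
    Module.finrank_pos_iff_exists_ne_zero.2 ⟨⟨g, hker⟩, fun h => hg0 (congrArg Subtype.val h)⟩
  omega

omit [FiniteDimensional ℂ K] in
/-- The restriction to `K` of the quadrics containing the cone over the Segre variety, when `K` does
not meet the cone. -/
theorem restriction_segreQuadrics (Q : Submodule ℂ (QuadraticForm ℂ S)) (hQ : Q = segreQuadrics e)
    (κ : K →ₗ[ℂ] S) (hκ : ∀ x α β, (e (κ x)).2 = Matrix.vecMulVec α β → x = 0) (k : ℕ)
    (hk : 0 < k) (hK : Module.finrank ℂ K = k) :
    (k ≤ 3 → Function.Surjective ((quadPullback κ).domRestrict Q) ∧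
      Module.finrank ℂ (LinearMap.ker ((quadPullback κ).domRestrict Q)) =
        9 - k * (k + 1) / 2) ∧
    (k = 4 → Function.Injective ((quadPullback κ).domRestrict Q) ∧
      IsCoatom (LinearMap.range ((quadPullback κ).domRestrict Q)) ∧
      ∃ p : symTensors K, LinearMap.range ((quadPullback κ).domRestrict Q) = hyperplaneOf p ∧
        tensorRank (p : K ⊗[ℂ] K) = 4) := by
  subst hQ
  have : FiniteDimensional ℂ K := FiniteDimensional.of_finrank_pos (hK ▸ hk)
  have hsum := LinearMap.finrank_range_add_finrank_ker
    ((quadPullback κ).domRestrict (segreQuadrics e))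
  have hdim := finrank_quadraticForm (K := K)
  have hrange := LinearMap.range_domRestrict (segreQuadrics e) (quadPullback κ)
  rw [finrank_segreQuadrics] at hsum
  rw [hK] at hdim
  refine ⟨fun hk3 => ?_, fun hk4 => ?_⟩
  · have htop := hrange.trans (map_quadPullback_eq_top e κ hκ (hK.trans_le hk3))
    refine ⟨LinearMap.range_eq_top.1 htop, ?_⟩
    rw [htop, finrank_top, hdim] at hsum
    omega
  · subst hk4
    obtain ⟨φ, hφ, hmap, hrank⟩ := exists_map_quadPullback_eq_ker e κ hκ hK
    have hφs : Function.Surjective φ := LinearMap.surjective hφ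
    have hker := hrange.trans hmap
    have h := LinearMap.finrank_range_add_finrank_ker φ
    rw [LinearMap.range_eq_top.2 hφs, finrank_top, Module.finrank_self, hdim] at h
    refine ⟨?_, ?_, ⟨functionalTensor φ, functionalTensor_mem_symTensors φ⟩, ?_,
      (tensorRank_functionalTensor φ).trans hrank⟩
    · rw [← LinearMap.ker_eq_bot, ← Submodule.finrank_eq_zero]
      rw [hker] at hsum
      omega
    · rw [hker]
      exact LinearMap.isCoatom_ker_of_surjective hφs
    · rw [hyperplaneOf, evalAtTensor_functionalTensor, hker]

end Segre

/-! ### Calculus of trivectors -/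

section Wedge

theorem update_vec_zero {V : Type*} (x y z t : V) : Function.update ![x, y, z] 0 t = ![t, y, z] := by
  ext i
  fin_cases i <;> rfl

theorem update_vec_two {V : Type*} (x y z t : V) : Function.update ![x, y, z] 2 t = ![x, y, t] := by
  ext i
  fin_cases i <;> rfl

variable {V : Type*} [AddCommGroup V] [Module ℂ V]

/-- The trivector `x ∧ y ∧ z`, as a linear function of `z`. -/
noncomputable def wedge (x y : V) : V →ₗ[ℂ] ⋀[ℂ]^3 V where
  toFun z := exteriorPower.ιMulti ℂ 3 ![x, y, z]
  map_add' z z' := by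
    have h := (exteriorPower.ιMulti ℂ 3).map_update_add ![x, y, z] 2 z z'
    simp only [update_vec_two] at h
    exact h
  map_smul' c z := by
    have h := (exteriorPower.ιMulti ℂ 3).map_update_smul ![x, y, z] 2 c z
    simp only [update_vec_two] at h
    exact h

theorem wedge_apply (x y z : V) : wedge x y z = exteriorPower.ιMulti ℂ 3 ![x, y, z] := rfl

theorem wedge_add_left (x x' y z : V) : wedge (x + x') y z = wedge x y z + wedge x' y z := by
  have h := (exteriorPower.ιMulti ℂ 3).map_update_add ![x, y, z] 0 x x'
  simp only [update_vec_zero] at h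
  exact h

theorem wedge_smul_left (c : ℂ) (x y z : V) : wedge (c • x) y z = c • wedge x y z := by
  have h := (exteriorPower.ιMulti ℂ 3).map_update_smul ![x, y, z] 0 c x
  simp only [update_vec_zero] at h
  exact h

theorem wedge_self (x z : V) : wedge x x z = 0 :=
  (exteriorPower.ιMulti ℂ 3).map_eq_zero_of_eq ![x, x, z] (i := 0) (j := 1) rfl (by decide)

theorem wedge_swap (x y z : V) : wedge x y z = - wedge y x z := by
  have h := (exteriorPower.ιMulti ℂ 3).map_swap ![y, x, z] (i := 0) (j := 1) (by decide)
  rw [wedge_apply, wedge_apply, ← h]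
  congr 1
  ext i
  fin_cases i <;> rfl

theorem wedge_swap_right (x y z : V) : wedge x y z = - wedge x z y := by
  have h := (exteriorPower.ιMulti ℂ 3).map_swap ![x, z, y] (i := 1) (j := 2) (by decide)
  rw [wedge_apply, wedge_apply, ← h]
  congr 1
  ext i
  fin_cases i <;> rfl

theorem wedge_cycle (x y z : V) : wedge x y z = wedge y z x := by
  rw [wedge_swap, wedge_swap_right, neg_neg]

theorem wedge_add_mid (x y y' z : V) : wedge x (y + y') z = wedge x y z + wedge x y' z := by
  rw [wedge_swap, wedge_add_left, wedge_swap x y, wedge_swap x y', neg_add]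

theorem wedge_smul_mid (c : ℂ) (x y z : V) : wedge x (c • y) z = c • wedge x y z := by
  rw [wedge_swap, wedge_smul_left, wedge_swap x y, smul_neg]

theorem wedge_self_right (x y : V) : wedge x y y = 0 := by
  rw [← wedge_cycle, wedge_cycle, wedge_cycle, wedge_self]

theorem wedge_self_outer (x y : V) : wedge x y x = 0 := by
  rw [wedge_cycle, wedge_self_right]

/-- The bivector `α y∧z + β z∧x + γ x∧y` factors as `(y - (β/α) x) ∧ (α z - γ x)`. Adding `(c/α) x`
to `w` then contributes exactly the term `c x∧y∧z`. -/
theorem isDecomposable_of_ne_zero (x y z w : V) (c α β γ : ℂ) (hα : α ≠ 0) :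
    IsDecomposable (c • wedge x y z +
      (α • wedge y z w + β • wedge z x w + γ • wedge x y w)) := by
  refine ⟨![y + (-(β / α)) • x, α • z + (-γ) • x, w + (c / α) • x], ?_⟩
  rw [← wedge_apply]
  simp only [wedge_add_left, wedge_add_mid, wedge_smul_left, wedge_smul_mid, map_add, map_smul,
    wedge_self, wedge_self_right, wedge_self_outer, smul_zero, add_zero]
  rw [← wedge_cycle x y z, wedge_swap y x w, wedge_swap x z w]
  match_scalars <;> field_simp

theorem isDecomposable_add (x y z w : V) (c α β γ : ℂ) :
    IsDecomposable (c • wedge x y z +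
      (α • wedge y z w + β • wedge z x w + γ • wedge x y w)) := by
  by_cases hα : α ≠ 0
  · exact isDecomposable_of_ne_zero x y z w c α β γ hα
  by_cases hβ : β ≠ 0
  · rw [wedge_cycle, add_rotate]
    exact isDecomposable_of_ne_zero y z x w c β γ α hβ
  by_cases hγ : γ ≠ 0
  · rw [wedge_cycle, wedge_cycle, ← add_rotate]
    exact isDecomposable_of_ne_zero z x y w c γ α β hγ
  push Not at hα hβ hγ
  rw [hα, hβ, hγ, zero_smul, zero_smul, zero_smul, add_zero, add_zero, add_zero]
  exact ⟨![x, y, c • z], by rw [← wedge_apply, map_smul]⟩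

end Wedge

/-! ### Plücker coordinates on the tangent space and decomposability -/

section Coordinates

open Sum

variable {V : Type*} [AddCommGroup V] [Module ℂ V]

theorem exists_adapted_basis (hV : Module.finrank ℂ V = 6) (U : Submodule ℂ V)
    (hU : Module.finrank ℂ U = 3) :
    ∃ b : Module.Basis (Fin 3 ⊕ Fin 3) ℂ V, ∀ v, v ∈ U ↔ ∀ j, b.repr v (inr j) = 0 := by
  have : FiniteDimensional ℂ V := Module.finite_of_finrank_eq_succ hV
  obtain ⟨W, hW⟩ := Submodule.exists_isCompl U
  have hW3 : Module.finrank ℂ W = 3 := by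
    have := Submodule.finrank_add_eq_of_isCompl hW
    omega
  refine ⟨((Module.finBasisOfFinrankEq ℂ U hU).prod (Module.finBasisOfFinrankEq ℂ W hW3)).map
    (U.prodEquivOfIsCompl W hW), fun v => ?_⟩
  rw [← Submodule.prodEquivOfIsCompl_symm_apply_snd_eq_zero U W hW]
  simp only [Module.Basis.map_repr, LinearEquiv.trans_apply, Module.Basis.prod_repr_inr]
  rw [← LinearEquiv.map_eq_zero_iff (Module.finBasisOfFinrankEq ℂ W hW3).repr, Finsupp.ext_iff]
  rfl

variable (b : Module.Basis (Fin 3 ⊕ Fin 3) ℂ V)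

/-- The Plücker coordinate with columns `s 0, s 1, s 2`. -/
noncomputable def pluecker (s : Fin 3 → Fin 3 ⊕ Fin 3) : ⋀[ℂ]^3 V →ₗ[ℂ] ℂ :=
  exteriorPower.alternatingMapLinearEquiv
    (Matrix.detRowAlternating.compLinearMap (LinearMap.pi fun c => b.coord (s c)))

theorem pluecker_ιMulti (s : Fin 3 → Fin 3 ⊕ Fin 3) (v : Fin 3 → V) :
    pluecker b s (exteriorPower.ιMulti ℂ 3 v) =
      (Matrix.of fun r c => b.repr (v r) (s c)).det := by
  rw [pluecker, exteriorPower.alternatingMapLinearEquiv_apply_ιMulti]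
  rfl

/-- The parametrization of `T_U` by `ℂ ⊕ M₃(ℂ)` given by a basis adapted to `U`. -/
noncomputable def ofSegre : SegreSpace →ₗ[ℂ] ⋀[ℂ]^3 V where
  toFun x := x.1 • wedge (b (inl 0)) (b (inl 1)) (b (inl 2)) +
    ∑ i, ∑ j, x.2 i j • wedge (b (inl (i + 1))) (b (inl (i + 2))) (b (inr j))
  map_add' x y := by
    simp only [Prod.fst_add, Prod.snd_add, Matrix.add_apply, add_smul, Finset.sum_add_distrib]
    abel
  map_smul' c x := by
    simp [mul_smul, Finset.smul_sum]

/-- The coordinates in `ℂ ⊕ M₃(ℂ)` of a trivector. -/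
noncomputable def toSegre : ⋀[ℂ]^3 V →ₗ[ℂ] SegreSpace where
  -- Putting `inr j` in position `i` is a cyclic reordering of `(i + 1, i + 2, j)`, hence even: no
  -- signs appear against `ofSegre`.
  toFun x := (pluecker b inl x,
    Matrix.of fun i j => pluecker b (Function.update inl i (inr j)) x)
  map_add' x y := by
    ext <;> simp
  map_smul' c x := by
    ext <;> simp

theorem toSegre_wedge_inl : toSegre b (wedge (b (inl 0)) (b (inl 1)) (b (inl 2))) = (1, 0) := by
  ext i j
  · simp [toSegre, wedge_apply, pluecker_ιMulti, Matrix.det_fin_three]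
  · simp only [toSegre, wedge_apply, LinearMap.coe_mk, AddHom.coe_mk, pluecker_ιMulti,
      Matrix.of_apply, Matrix.zero_apply]
    exact Matrix.det_eq_zero_of_column_eq_zero i fun r => by fin_cases r <;> simp

theorem toSegre_wedge_inr (i j : Fin 3) :
    toSegre b (wedge (b (inl (i + 1))) (b (inl (i + 2))) (b (inr j))) =
      (0, Matrix.single i j 1) := by
  ext k l
  · simp [toSegre, wedge_apply, pluecker_ιMulti, Matrix.det_fin_three]
  · simp only [toSegre, wedge_apply, LinearMap.coe_mk, AddHom.coe_mk, pluecker_ιMulti,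
      Matrix.of_apply, Matrix.det_fin_three]
    fin_cases i <;> fin_cases k <;>
      simp [Function.update, Matrix.single_apply, Finsupp.single_apply]

theorem toSegre_ofSegre (x : SegreSpace) : toSegre b (ofSegre b x) = x := by
  simp only [ofSegre, LinearMap.coe_mk, AddHom.coe_mk, map_add, map_smul, map_sum,
    toSegre_wedge_inl, toSegre_wedge_inr]
  ext k l
  · simp [Prod.fst_sum]
  · conv_rhs => rw [Matrix.matrix_eq_sum_single x.2]
    simp [Prod.snd_sum]

theorem wedge_inl_mem_range (i : Fin 3) (v : V) :
    wedge (b (inl (i + 1))) (b (inl (i + 2))) v ∈ LinearMap.range (ofSegre b) := by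
  have h0 : wedge (b (inl 0)) (b (inl 1)) (b (inl 2)) ∈ LinearMap.range (ofSegre b) :=
    ⟨(1, 0), by simp [ofSegre]⟩
  rw [← b.sum_repr v, map_sum, Fintype.sum_sum_type]
  refine add_mem (Submodule.sum_mem _ fun k _ => ?_) (Submodule.sum_mem _ fun k _ => ?_)
  · rw [map_smul]
    refine Submodule.smul_mem _ _ ?_
    have h1 : ∀ i k : Fin 3, k = i ∨ k = i + 1 ∨ k = i + 2 := by decide
    rcases h1 i k with rfl | rfl | rfl
    · fin_cases k
      · exact wedge_cycle (b (inl 0)) (b (inl 1)) (b (inl 2)) ▸ h0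
      · exact (wedge_cycle (b (inl 2)) (b (inl 0)) (b (inl 1))).symm ▸ h0
      · exact h0
    · rw [wedge_self_outer]
      exact zero_mem _
    · rw [wedge_self_right]
      exact zero_mem _
  · rw [map_smul]
    refine Submodule.smul_mem _ _ ⟨(0, Matrix.single i k 1), ?_⟩
    simp only [ofSegre, LinearMap.coe_mk, AddHom.coe_mk, zero_smul, zero_add]
    rw [Finset.sum_eq_single i, Finset.sum_eq_single k]
    · simp
    · intro j _ hj
      simp [hj.symm]
    · simp
    · intro j _ hj
      simp [hj.symm]
    · simp

variable {b} {U : Submodule ℂ V} (hb : ∀ v, v ∈ U ↔ ∀ j, b.repr v (inr j) = 0)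
include hb

theorem range_ofSegre : LinearMap.range (ofSegre b) = tangentSpace U := by
  have hinl : ∀ i, b (inl i) ∈ U := fun i => (hb _).2 fun j => by simp
  apply le_antisymm
  · rintro _ ⟨x, rfl⟩
    refine add_mem (Submodule.smul_mem _ _ (Submodule.subset_span
      ⟨_, hinl _, _, hinl _, _, rfl⟩)) (Submodule.sum_mem _ fun i _ => Submodule.sum_mem _
        fun j _ => Submodule.smul_mem _ _ (Submodule.subset_span ⟨_, hinl _, _, hinl _, _, rfl⟩))
  · rw [tangentSpace, Submodule.span_le]
    rintro _ ⟨u, hu, u', hu', v, rfl⟩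
    have hsum : ∀ u ∈ U, u = b.repr u (inl 0) • b (inl 0) + b.repr u (inl 1) • b (inl 1) +
        b.repr u (inl 2) • b (inl 2) := by
      intro u hu
      conv_lhs => rw [← b.sum_repr u, Fintype.sum_sum_type]
      simp [(hb u).1 hu, Fin.sum_univ_three]
    rw [SetLike.mem_coe, ← wedge_apply, hsum u hu, hsum u' hu']
    generalize b.repr u (inl 0) = p0, b.repr u (inl 1) = p1, b.repr u (inl 2) = p2,
      b.repr u' (inl 0) = q0, b.repr u' (inl 1) = q1, b.repr u' (inl 2) = q2
    have h0 := wedge_inl_mem_range b 0 v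
    have h1 := wedge_inl_mem_range b 1 v
    have h2 := wedge_inl_mem_range b 2 v
    have key : wedge (p0 • b (inl 0) + p1 • b (inl 1) + p2 • b (inl 2))
        (q0 • b (inl 0) + q1 • b (inl 1) + q2 • b (inl 2)) v =
        (p1 * q2 - p2 * q1) • wedge (b (inl 1)) (b (inl 2)) v +
        (p2 * q0 - p0 * q2) • wedge (b (inl 2)) (b (inl 0)) v +
        (p0 * q1 - p1 * q0) • wedge (b (inl 0)) (b (inl 1)) v := by
      simp only [wedge_add_left, wedge_add_mid, wedge_smul_left, wedge_smul_mid, wedge_self,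
        smul_zero]
      rw [wedge_swap (b (inl 2)) (b (inl 1)), wedge_swap (b (inl 0)) (b (inl 2)),
        wedge_swap (b (inl 1)) (b (inl 0))]
      module
    rw [key]
    exact add_mem (add_mem (Submodule.smul_mem _ _ h0) (Submodule.smul_mem _ _ h1))
      (Submodule.smul_mem _ _ h2)

/-- Two factors of each generator lie in `U`, so their rows vanish in the two columns taken outside
`U`. -/
theorem pluecker_eq_zero_of_mem {x : ⋀[ℂ]^3 V} (hx : x ∈ tangentSpace U) (i j : Fin 3) :
    pluecker b (Function.update inr i (inl j)) x = 0 := by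
  suffices h : tangentSpace U ≤ LinearMap.ker (pluecker b (Function.update inr i (inl j))) from
    h hx
  rw [tangentSpace, Submodule.span_le]
  rintro _ ⟨u, hu, u', hu', v, rfl⟩
  rw [SetLike.mem_coe, LinearMap.mem_ker, pluecker_ιMulti, Matrix.det_fin_three]
  fin_cases i <;> simp [Function.update, (hb u).1 hu, (hb u').1 hu']

omit hb

theorem exists_eq_vecMulVec_of_adjugate_eq_zero {M : Matrix (Fin 3) (Fin 3) ℂ}
    (hM : M.adjugate = 0) : ∃ α β : Fin 3 → ℂ, M = Matrix.vecMulVec α β := by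
  have h : ∀ i j, M.adjugate i j = 0 := fun i j => by rw [hM]; rfl
  simp only [Matrix.adjugate_fin_three] at h
  have h00 := h 0 0
  have h01 := h 0 1
  have h02 := h 0 2
  have h10 := h 1 0
  have h11 := h 1 1
  have h12 := h 1 2
  have h20 := h 2 0
  have h21 := h 2 1
  have h22 := h 2 2
  simp at h00 h01 h02 h10 h11 h12 h20 h21 h22
  have hminor : ∀ i j k l, M i j * M k l = M i l * M k j := by
    intro i j k l
    fin_cases i <;> fin_cases k <;> fin_cases j <;> fin_cases l <;> simp <;> grind
  by_cases h0 : M = 0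
  · exact ⟨0, 0, by rw [h0, Matrix.zero_vecMulVec]⟩
  obtain ⟨k, l, hkl⟩ : ∃ k l, M k l ≠ 0 := by
    by_contra! hcon
    exact h0 (Matrix.ext hcon)
  -- With all `2 × 2` minors zero, every row is a multiple of row `k`, with ratio read off in column
  -- `l`.
  refine ⟨fun i => M i l / M k l, fun j => M k j, ?_⟩
  ext i j
  rw [Matrix.vecMulVec_apply]
  field_simp
  exact hminor i j k l

include hb

/-- Write the three factors as the rows of a block matrix `(A | B)`. Cramer's rule gives the Segre
matrix as `adj(A) B`, and membership in `T_U` gives `adj(B) A = 0`. Its adjugate is then `adj(B)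
adj(adj A) = det(A) adj(B) A = 0`, so its rank is at most one. Conversely, a matrix `α βᵗ` lets a
single vector `w = ∑ βⱼ bⱼ` be factored out, and `isDecomposable_add` applies. -/
theorem isDecomposable_iff {x : ⋀[ℂ]^3 V} (hx : x ∈ tangentSpace U) :
    IsDecomposable x ↔ ∃ α β, (toSegre b x).2 = Matrix.vecMulVec α β := by
  constructor
  · rintro ⟨v, rfl⟩
    let A : Matrix (Fin 3) (Fin 3) ℂ := Matrix.of fun r c => b.repr (v r) (inl c)
    let B : Matrix (Fin 3) (Fin 3) ℂ := Matrix.of fun r c => b.repr (v r) (inr c)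
    have hX : (toSegre b (exteriorPower.ιMulti ℂ 3 v)).2 = A.adjugate * B := by
      ext i j
      change pluecker b (Function.update inl i (inr j)) (exteriorPower.ιMulti ℂ 3 v) =
        (A.adjugate.mulVec (fun r => B r j)) i
      rw [← Matrix.cramer_eq_adjugate_mulVec, Matrix.cramer_apply, pluecker_ιMulti]
      congr 1
      ext r c
      by_cases hc : c = i
      · subst hc
        simp [B]
      · simp [hc, A]
    have hY : B.adjugate * A = 0 := by
      ext i j
      change (B.adjugate.mulVec (fun r => A r j)) i = 0
      rw [← Matrix.cramer_eq_adjugate_mulVec, Matrix.cramer_apply,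
        ← pluecker_eq_zero_of_mem hb hx i j, pluecker_ιMulti]
      congr 1
      ext r c
      by_cases hc : c = i
      · subst hc
        simp [A]
      · simp [hc, B]
    apply exists_eq_vecMulVec_of_adjugate_eq_zero
    rw [hX, Matrix.adjugate_mul_distrib, Matrix.adjugate_adjugate', Matrix.mul_smul, hY, smul_zero]
  · rintro ⟨α, β, h⟩
    rw [← range_ofSegre hb] at hx
    obtain ⟨y, rfl⟩ := hx
    rw [toSegre_ofSegre] at h
    have hsum : ofSegre b y = y.1 • wedge (b (inl 0)) (b (inl 1)) (b (inl 2)) +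
        (α 0 • wedge (b (inl 1)) (b (inl 2)) (∑ j, β j • b (inr j)) +
        α 1 • wedge (b (inl 2)) (b (inl 0)) (∑ j, β j • b (inr j)) +
        α 2 • wedge (b (inl 0)) (b (inl 1)) (∑ j, β j • b (inr j))) := by
      simp only [ofSegre, LinearMap.coe_mk, AddHom.coe_mk, h, Matrix.vecMulVec_apply, map_sum,
        map_smul, Finset.smul_sum, smul_smul]
      congr 1
      exact Fin.sum_univ_three _
    rw [hsum]
    exact isDecomposable_add _ _ _ _ _ _ _ _

/-- The identification of `T_U` with `ℂ ⊕ M₃(ℂ)` given by a basis adapted to `U`. -/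
noncomputable def tangentSpaceEquiv : tangentSpace U ≃ₗ[ℂ] SegreSpace where
  toLinearMap := toSegre b ∘ₗ (tangentSpace U).subtype
  invFun x := ⟨ofSegre b x, range_ofSegre hb ▸ ⟨x, rfl⟩⟩
  left_inv := by
    rintro ⟨x, hx⟩
    obtain ⟨y, rfl⟩ := (range_ofSegre hb).symm ▸ hx
    exact Subtype.ext (congrArg (ofSegre b) (toSegre_ofSegre b y))
  right_inv x := toSegre_ofSegre b x

end Coordinates

/-! ### Transfer from the Segre model to the tangent space, and the main theorem -/

variable {V : Type*} [AddCommGroup V] [Module ℂ V] {U : Submodule ℂ V}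
  {b : Module.Basis (Fin 3 ⊕ Fin 3) ℂ V}

theorem tangentSpaceEquiv_apply (hb : ∀ v, v ∈ U ↔ ∀ j, b.repr v (Sum.inr j) = 0)
    (x : tangentSpace U) : tangentSpaceEquiv hb x = toSegre b x := rfl

theorem quadricsThroughCone_eq (hb : ∀ v, v ∈ U ↔ ∀ j, b.repr v (Sum.inr j) = 0) :
    quadricsThroughCone U = segreQuadrics (S := tangentSpace U) (tangentSpaceEquiv hb) := by
  ext q
  constructor
  · intro hq c α β
    refine hq _ ((isDecomposable_iff hb (Subtype.prop _)).2 ⟨α, β, ?_⟩)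
    rw [← tangentSpaceEquiv_apply hb, LinearEquiv.apply_symm_apply]
  · intro hq x hx
    obtain ⟨α, β, h⟩ := (isDecomposable_iff hb x.2).1 hx
    have h' := hq (toSegre b x).1 α β
    rw [← h] at h'
    rw [← (tangentSpaceEquiv hb).symm_apply_apply x]
    exact h'

theorem eq_zero_of_toSegre_eq_vecMulVec {A : Submodule ℂ (⋀[ℂ]^3 V)} (hdec : HasNoDecomposable A)
    (hb : ∀ v, v ∈ U ↔ ∀ j, b.repr v (Sum.inr j) = 0) (x : interTangent A U) (α β : Fin 3 → ℂ)
    (h : (tangentSpaceEquiv hb (Submodule.inclusion inf_le_right x)).2 = Matrix.vecMulVec α β) :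
    x = 0 :=
  Subtype.ext (hdec x x.2.1 ((isDecomposable_iff hb x.2.2).2 ⟨α, β, h⟩))

end EPWCube

theorem mainTheorem7 {V : Type*} [AddCommGroup V] [Module ℂ V]
    (hV : Module.finrank ℂ V = 6)
    (A : Submodule ℂ (⋀[ℂ]^3 V)) (hA : EPWCube.IsLagrangian A)
    (hdec : EPWCube.HasNoDecomposable A)
    (k : ℕ) (hk : k ∈ ({1, 2, 3, 4} : Set ℕ))
    (U₀ : Submodule ℂ V) (hU₀ : U₀ ∈ EPWCube.stratum A k) :
    (k ≤ 3 →
      Function.Surjective (EPWCube.restrictionMap A U₀) ∧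
      Module.finrank ℂ (LinearMap.ker (EPWCube.restrictionMap A U₀)) = 9 - k * (k + 1) / 2) ∧
    (k = 4 →
      Function.Injective (EPWCube.restrictionMap A U₀) ∧
      IsCoatom (LinearMap.range (EPWCube.restrictionMap A U₀)) ∧
      ∃ p : EPWCube.symTensors (EPWCube.interTangent A U₀),
        LinearMap.range (EPWCube.restrictionMap A U₀) =
          EPWCube.hyperplaneOf (K := EPWCube.interTangent A U₀) p ∧
        EPWCube.tensorRank (K := EPWCube.interTangent A U₀) p = 4) := by
  obtain ⟨hU, hK⟩ := hU₀
  obtain ⟨b, hb⟩ := EPWCube.exists_adapted_basis hV U₀ hU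
  have hkpos : 0 < k := by
    rcases hk with rfl | rfl | rfl | rfl <;> norm_num
  exact EPWCube.restriction_segreQuadrics (S := EPWCube.tangentSpace U₀)
    (K := EPWCube.interTangent A U₀) (EPWCube.tangentSpaceEquiv hb)
    (EPWCube.quadricsThroughCone U₀) (EPWCube.quadricsThroughCone_eq hb)
    (Submodule.inclusion inf_le_right)
    (EPWCube.eq_zero_of_toSegre_eq_vecMulVec hdec hb) k hkpos hK
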